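/- Let $\Phi$ be an irreducible root system (finite, crystallographic and reduced) in a vector space over a field of characteristic $0$ (for example $\mathbb{R}$). Fix a simple system $\Delta=\{\alpha_1,\dots,\alpha_\ell\}$ of $\Phi$, and let $\Phi^+$ be the corresponding set of positive roots. For $\alpha=\sum_{i=1}^{\ell}c_i\alpha_i\in\Phi^+$ let $\mathrm{Ht}(\alpha)=\sum_{i=1}^{\ell}c_i$ be its height. Then for every $\alpha\in\Phi^+$, $$ \mathrm{Ht}(\alpha)-1=\bigl|\{\{\beta_1,\beta_2\}\subseteq\Phi^+ \mid \alpha\in\mathbb{Z}_{>0}\,\beta_1+\mathbb{Z}_{>0}\,\beta_2\}\bigr|, $$ that is, $\mathrm{Ht}(\alpha)-1$ is the number of unordered pairs $\{\beta_1,\beta_2\}$ of positive roots such that $\alpha=m\beta_1+n\beta_2$ for some positive integers $m,n$. -/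

import Mathlib

namespace RootPairing.Base

open Set

variable {ι K M N : Type*} [Field K] [CharZero K]
  [AddCommGroup M] [Module K M] [AddCommGroup N] [Module K N]
  {P : RootPairing ι K M N} {b : P.Base}

/-! Induct on the height. A positive root α pairs positively with some simple αⱼ; let p be this
pairing. If α ≠ αⱼ, then sⱼα = α - pαⱼ is a positive root of height Ht(α) - p, so it suffices that
passing to it loses exactly p pairs. Since sⱼ permutes the positive roots other than αⱼ, it matches
the pairs avoiding αⱼ (`ncard_posPairs_notMem_reflectionPerm`). A pair containing αⱼ is encoded by
the coefficient z of αⱼ (`ncard_posPairs_mem`): the values z > p for α are those for sⱼα shifted by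
p, and the root string through α provides every z = 1, …, p (`ncard_posSubCoeffs_reflectionPerm`).
-/

lemma height_zsmul_add_zsmul {i j k : ι} {m n : ℤ}
    (h : P.root i = m • P.root j + n • P.root k) :
    b.height i = m * b.height j + n * b.height k := by
  obtain ⟨f, -, -, hf⟩ := b.exists_root_eq_sum_int j
  obtain ⟨g, -, -, hg⟩ := b.exists_root_eq_sum_int k
  have hfg : P.root i = ∑ l ∈ b.support, (m • f + n • g) l • P.root l := by
    simp_rw [Pi.add_apply, Pi.smul_apply, add_smul, smul_assoc, Finset.sum_add_distrib,
      ← Finset.smul_sum, ← hf, ← hg, h]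
  simp_rw [height_eq_sum hf, height_eq_sum hg, height_eq_sum hfg, Pi.add_apply, Pi.smul_apply,
    Finset.sum_add_distrib, smul_eq_mul, Finset.mul_sum]

lemma IsPos.linearIndependent_pair [P.IsReduced] {i j : ι} (hi : b.IsPos i) (hj : b.IsPos j)
    (hij : i ≠ j) : LinearIndependent ℤ ![P.root i, P.root j] := by
  refine (IsReduced.linearIndependent P hij fun contra ↦ ?_).restrict_scalars' ℤ
  have h : P.root i = (-1 : ℤ) • P.root j + (0 : ℤ) • P.root j := by simp [contra]
  have := height_zsmul_add_zsmul (b := b) h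
  rw [isPos_iff] at hi hj
  lia

lemma IsPos.eq_of_zsmul_eq [P.IsReduced] {i j : ι} (hi : b.IsPos i) (hj : b.IsPos j)
    {m n : ℤ} (hm : m ≠ 0) (h : m • P.root i = n • P.root j) : i = j := by
  by_contra hij
  have := LinearIndependent.pair_iff.mp (hi.linearIndependent_pair hj hij) m (-n) (by simp [h])
  exact hm this.1

lemma IsPos.eq_of_zsmul_eq_sub_zsmul [P.IsReduced] {i j k : ι} {m n z w : ℤ} (hi : b.IsPos i)
    (hj : b.IsPos j) (hij : i ≠ j) (hm : m ≠ 0) (h : m • P.root k = P.root i - z • P.root j)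
    (h' : n • P.root k = P.root i - w • P.root j) : z = w := by
  have hlin := LinearIndependent.pair_iff.mp (hi.linearIndependent_pair hj hij) (n - m)
    (m * w - n * z) (by
      have : n • m • P.root k - m • n • P.root k = 0 := by module
      rw [h, h'] at this
      rw [← this]
      module)
  obtain rfl : n = m := by lia
  exact mul_left_cancel₀ hm (by lia)

/-- A root that is a positive rational multiple of `α + z αⱼ`, with `α` positive and `αⱼ ≠ α`
simple, is positive. -/
lemma IsPos.of_zsmul_eq_add_zsmul [P.IsReduced] {i j k : ι} {n z : ℤ} (hi : b.IsPos i)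
    (hj : j ∈ b.support) (hij : i ≠ j) (hn : 0 < n)
    (h : n • P.root k = P.root i + z • P.root j) : b.IsPos k := by
  classical
  obtain ⟨f, hf₀, hf₁, hf⟩ := b.exists_root_eq_sum_int i
  obtain ⟨g, -, hg₁, hg⟩ := b.exists_root_eq_sum_int k
  by_contra hk
  have hf_nonneg : 0 ≤ f := by
    refine (hf₁.resolve_right fun hf₁ ↦ ?_).le
    rw [isPos_iff, height_eq_sum hf] at hi
    exact hi.not_ge <| Finset.sum_nonpos fun l _ ↦ hf₁.le l
  have hg_nonpos : g ≤ 0 := by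
    refine (hg₁.resolve_left fun hg₁ ↦ ?_).le
    rw [isPos_iff', height_eq_sum hg] at hk
    exact hk <| Finset.sum_nonneg fun l _ ↦ hg₁.le l
  have hj' : P.root j = ∑ l ∈ b.support, (Pi.single j 1 : ι → ℤ) l • P.root l := by
    rw [Finset.sum_eq_single_of_mem j hj (by simp_all)]; simp
  have hsum : ∑ l ∈ b.support, (n • g - f - z • Pi.single j 1 : ι → ℤ) l • P.root l = 0 := by
    simp_rw [Pi.sub_apply, Pi.smul_apply, sub_smul, smul_assoc, Finset.sum_sub_distrib,
      ← Finset.smul_sum, ← hf, ← hg, ← hj', h]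
    abel
  have hcoeff := linearIndepOn_finset_iff.mp (b.linearIndepOn_root.restrict_scalars' ℤ) _ hsum
  -- Away from `j`, `n * g l = f l` with `g l ≤ 0 ≤ f l`, so both sides vanish and `i` is a multiple
  -- of the simple root `j`.
  have hf_zero : ∀ l ∈ b.support, l ≠ j → f l = 0 := by
    intro l hl hlj
    have := hcoeff l hl
    simp only [Pi.sub_apply, Pi.smul_apply, Pi.single_eq_of_ne hlj, smul_eq_mul] at this
    have h₁ : 0 ≤ f l := hf_nonneg l
    have h₂ : g l ≤ 0 := hg_nonpos l
    nlinarith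
  have hfj : P.root i = f j • P.root j := by
    rw [hf]
    exact Finset.sum_eq_single_of_mem j hj fun l hl hlj ↦ by simp [hf_zero l hl hlj]
  exact hij <| hi.eq_of_zsmul_eq (b.isPos_of_mem_support hj) one_ne_zero (by simpa using hfj)

lemma IsPos.reflectionPerm_ne [P.IsReduced] {i j : ι} (hi : b.IsPos i) (hj : j ∈ b.support)
    (hij : i ≠ j) : P.reflectionPerm j i ≠ j := by
  intro h
  have h' : P.root i = (-1 : ℤ) • P.root j := by
    have := congrArg (P.reflection j) (congrArg P.root h)
    simpa using this
  exact hij <| hi.eq_of_zsmul_eq (b.isPos_of_mem_support hj) one_ne_zero (by rw [one_smul, h'])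

variable (b) in
/-- The unordered pairs of positive roots such that the root `i` is a combination of them with
positive integral coefficients. -/
def posPairs (i : ι) : Set (Set ι) :=
  {s | ∃ j k : ι, s = {j, k} ∧ b.IsPos j ∧ b.IsPos k ∧
    ∃ m n : ℤ, 0 < m ∧ 0 < n ∧ P.root i = m • P.root j + n • P.root k}

lemma posPairs_eq_empty {i : ι} (hi : i ∈ b.support) : b.posPairs i = ∅ := by
  rw [eq_empty_iff_forall_notMem]
  rintro - ⟨j, k, -, hj, hk, m, n, hm, hn, h⟩
  have := height_zsmul_add_zsmul (b := b) h
  rw [height_one_of_mem_support hi] at this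
  rw [isPos_iff] at hj hk
  nlinarith [mul_pos hm hj, mul_pos hn hk]

variable (P) in
/-- The positive integers `z` such that `αᵢ - z αⱼ` is a positive integral multiple of a root. -/
def posSubCoeffs (i j : ι) : Set ℤ :=
  {z | 0 < z ∧ ∃ k, ∃ n : ℤ, 0 < n ∧ n • P.root k = P.root i - z • P.root j}

lemma finite_posSubCoeffs [Finite ι] [P.IsReduced] {i j : ι} (hi : b.IsPos i) (hj : b.IsPos j)
    (hij : i ≠ j) : (posSubCoeffs P i j).Finite := by
  refine Finite.of_injective (fun z : posSubCoeffs P i j ↦ z.2.2.choose) fun z w hzw ↦ ?_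
  obtain ⟨m, hm, h⟩ := z.2.2.choose_spec
  obtain ⟨n, -, h'⟩ := w.2.2.choose_spec
  rw [← show z.2.2.choose = w.2.2.choose from hzw] at h'
  exact Subtype.ext <| hi.eq_of_zsmul_eq_sub_zsmul hj hij hm.ne' h h'

lemma mem_posPairs_and_mem_iff [P.IsReduced] {i j : ι} (hi : b.IsPos i) (hj : j ∈ b.support)
    (hij : i ≠ j) (s : Set ι) :
    s ∈ {s ∈ b.posPairs i | j ∈ s} ↔ ∃ k, ∃ m n : ℤ, s = {j, k} ∧ j ≠ k ∧ b.IsPos k ∧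
      0 < m ∧ 0 < n ∧ n • P.root k = P.root i - m • P.root j := by
  constructor
  · have key (k : ι) (m n : ℤ) (hk : b.IsPos k) (hm : 0 < m) (hn : 0 < n)
        (h : P.root i = m • P.root j + n • P.root k) : ∃ k', ∃ m n : ℤ,
        ({j, k} : Set ι) = {j, k'} ∧ j ≠ k' ∧ b.IsPos k' ∧ 0 < m ∧ 0 < n ∧
          n • P.root k' = P.root i - m • P.root j := by
      refine ⟨k, m, n, rfl, ?_, hk, hm, hn, by rw [h]; abel⟩
      rintro rfl
      exact hij <| hi.eq_of_zsmul_eq hk one_ne_zero (n := m + n) (by rw [h]; module)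
    rintro ⟨⟨k, l, rfl, hk, hl, m, n, hm, hn, h⟩, rfl | rfl⟩
    · exact key l m n hl hm hn h
    · rw [pair_comm]
      exact key k n m hk hn hm (by rw [h, add_comm])
  · rintro ⟨k, m, n, rfl, -, hk, hm, hn, h⟩
    exact ⟨⟨j, k, rfl, b.isPos_of_mem_support hj, hk, m, n, hm, hn, by rw [h]; abel⟩,
      mem_insert _ _⟩

/-- The coefficient of αⱼ determines the other root, because proportional positive roots coincide;
conversely, the other root determines the coefficient by linear independence of αᵢ and αⱼ. -/
lemma ncard_posPairs_mem [P.IsReduced] {i j : ι} (hi : b.IsPos i) (hj : j ∈ b.support)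
    (hij : i ≠ j) :
    {s ∈ b.posPairs i | j ∈ s}.ncard = (posSubCoeffs P i j).ncard := by
  have hjp := b.isPos_of_mem_support hj
  have hpos (k : ι) (n z : ℤ) (hn : 0 < n) (h : n • P.root k = P.root i - z • P.root j) :
      b.IsPos k :=
    hi.of_zsmul_eq_add_zsmul hj hij hn (z := -z) (by rw [h]; module)
  have hne (k : ι) (n z : ℤ) (h : n • P.root k = P.root i - z • P.root j) : j ≠ k := by
    rintro rfl
    exact hij <| hi.eq_of_zsmul_eq hjp one_ne_zero (n := n + z) (by rw [add_smul, h]; simp)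
  symm
  refine ncard_congr (fun z (hz : z ∈ posSubCoeffs P i j) ↦ {j, hz.2.choose}) ?_ ?_ ?_
  · intro z hz
    obtain ⟨n, hn, h⟩ := hz.2.choose_spec
    exact (mem_posPairs_and_mem_iff hi hj hij _).mpr
      ⟨_, z, n, rfl, hne _ _ _ h, hpos _ _ _ hn h, hz.1, hn, h⟩
  · intro z w hz hw hzw
    obtain ⟨m, hm, h⟩ := hz.2.choose_spec
    obtain ⟨n, hn, h'⟩ := hw.2.choose_spec
    have hk : hz.2.choose = hw.2.choose := by
      have : hz.2.choose ∈ ({j, hw.2.choose} : Set ι) := hzw ▸ mem_insert_of_mem _ rfl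
      exact this.resolve_left (hne _ _ _ h).symm
    rw [← hk] at h'
    exact hi.eq_of_zsmul_eq_sub_zsmul hjp hij hm.ne' h h'
  · intro s hs
    obtain ⟨k, m, n, rfl, -, hk, hm, hn, h⟩ := (mem_posPairs_and_mem_iff hi hj hij _).mp hs
    have hz : m ∈ posSubCoeffs P i j := ⟨hm, k, n, hn, h⟩
    refine ⟨m, hz, ?_⟩
    obtain ⟨n', hn', h'⟩ := hz.2.choose_spec
    rw [(hpos _ _ _ hn' h').eq_of_zsmul_eq hk hn'.ne' (h'.trans h.symm)]

lemma image_posPairs_notMem_subset [Finite ι] [P.IsCrystallographic] [P.IsReduced] (i : ι) {j : ι}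
    (hj : j ∈ b.support) :
    image (P.reflectionPerm j) '' {s ∈ b.posPairs i | j ∉ s} ⊆
      {s ∈ b.posPairs (P.reflectionPerm j i) | j ∉ s} := by
  rintro - ⟨-, ⟨⟨k, l, rfl, hk, hl, m, n, hm, hn, h⟩, hjs⟩, rfl⟩
  simp only [mem_insert_iff, mem_singleton_iff, not_or] at hjs
  have hk' := hk.reflectionPerm hj (Ne.symm hjs.1)
  have hl' := hl.reflectionPerm hj (Ne.symm hjs.2)
  refine ⟨⟨_, _, image_pair _ _ _, hk', hl', m, n, hm, hn, by simp [h]⟩, ?_⟩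
  rw [image_pair]
  rintro (h | h)
  exacts [hk.reflectionPerm_ne hj (Ne.symm hjs.1) h.symm,
    hl.reflectionPerm_ne hj (Ne.symm hjs.2) h.symm]

lemma ncard_posPairs_notMem_reflectionPerm [Finite ι] [P.IsCrystallographic] [P.IsReduced] (i : ι)
    {j : ι} (hj : j ∈ b.support) :
    {s ∈ b.posPairs (P.reflectionPerm j i) | j ∉ s}.ncard = {s ∈ b.posPairs i | j ∉ s}.ncard := by
  have hinj : Function.Injective (image (P.reflectionPerm j)) :=
    image_injective.mpr (P.reflectionPerm j).injective
  have key (i : ι) : {s ∈ b.posPairs i | j ∉ s}.ncard ≤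
      {s ∈ b.posPairs (P.reflectionPerm j i) | j ∉ s}.ncard := by
    rw [← ncard_image_of_injective _ hinj]
    exact ncard_le_ncard (image_posPairs_notMem_subset i hj)
  -- The reflection is an involution, so the inequality for its image is the reverse one.
  exact le_antisymm (by simpa using key (P.reflectionPerm j i)) (key i)

lemma ncard_posSubCoeffs_reflectionPerm [Finite ι] [P.IsCrystallographic] [P.IsReduced] {i j : ι}
    (hi : b.IsPos i) (hj : j ∈ b.support) (hij : i ≠ j) (hp : 0 ≤ P.pairingIn ℤ i j) :
    ((posSubCoeffs P i j).ncard : ℤ) =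
      (posSubCoeffs P (P.reflectionPerm j i) j).ncard + P.pairingIn ℤ i j := by
  set p := P.pairingIn ℤ i j
  have hjp := b.isPos_of_mem_support hj
  have hij' := hi.reflectionPerm_ne hj hij
  have hroot : P.root (P.reflectionPerm j i) = P.root i - p • P.root j := by
    rw [root_reflectionPerm, reflection_apply_root' ℤ]
  have hlin : LinearIndependent K ![P.root j, P.root i] := by
    refine IsReduced.linearIndependent P hij.symm fun contra ↦ hij ?_
    exact hi.eq_of_zsmul_eq hjp one_ne_zero (n := -1) (by simp [contra])
  have hdiff : posSubCoeffs P i j = Icc 1 p ∪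
      (· + p) '' posSubCoeffs P (P.reflectionPerm j i) j := by
    ext z
    simp only [mem_union, mem_Icc, mem_image, posSubCoeffs, mem_ofPred_eq, hroot]
    constructor
    · rintro ⟨hz, k, n, hn, h⟩
      rcases le_or_gt z p with hzp | hzp
      · exact Or.inl ⟨hz, hzp⟩
      · exact Or.inr ⟨z - p, ⟨by lia, k, n, hn, by rw [h]; module⟩, by simp⟩
    · rintro (⟨hz, hzp⟩ | ⟨z, ⟨hz, k, n, hn, h⟩, rfl⟩)
      -- The αⱼ-string through αᵢ extends downwards `p` steps more than upwards, hence at least `p`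
      -- steps, so αᵢ - zαⱼ is itself a root.
      · obtain ⟨k, hk⟩ := (P.root_sub_zsmul_mem_range_iff hlin (z := z)).mpr (by
          have := P.chainBotCoeff_sub_chainTopCoeff hlin
          rw [mem_Icc]
          lia)
        exact ⟨hz, k, 1, one_pos, by rw [hk, one_smul]⟩
      · exact ⟨by lia, k, n, hn, by rw [h]; module⟩
  have hdisj : Disjoint (Icc 1 p) ((· + p) '' posSubCoeffs P (P.reflectionPerm j i) j) := by
    rw [disjoint_left]
    rintro - hz ⟨z, hz', rfl⟩
    have := hz'.1
    have := hz.2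
    lia
  rw [hdiff, ncard_union_eq hdisj (finite_Icc _ _)
      ((finite_posSubCoeffs (hi.reflectionPerm hj hij) hjp hij').image _),
    ncard_image_of_injective _ (add_left_injective p), ← Finset.coe_Icc, ncard_coe_finset,
    Int.card_Icc]
  lia

lemma ncard_posPairs_reflectionPerm [Finite ι] [P.IsCrystallographic] [P.IsReduced] {i j : ι}
    (hi : b.IsPos i) (hj : j ∈ b.support) (hij : i ≠ j) (hp : 0 ≤ P.pairingIn ℤ i j) :
    ((b.posPairs i).ncard : ℤ) =
      (b.posPairs (P.reflectionPerm j i)).ncard + P.pairingIn ℤ i j := by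
  have hsplit (i : ι) : (b.posPairs i).ncard =
      {s ∈ b.posPairs i | j ∈ s}.ncard + {s ∈ b.posPairs i | j ∉ s}.ncard :=
    (ncard_inter_add_ncard_sdiff_eq_ncard (b.posPairs i) {s | j ∈ s} (toFinite _)).symm
  have hi' := hi.reflectionPerm hj hij
  have hij' := hi.reflectionPerm_ne hj hij
  rw [hsplit i, hsplit (P.reflectionPerm j i), ncard_posPairs_mem hi hj hij,
    ncard_posPairs_mem hi' hj hij', ncard_posPairs_notMem_reflectionPerm i hj]
  have := ncard_posSubCoeffs_reflectionPerm hi hj hij hp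
  push_cast
  lia

theorem height_sub_one_eq_ncard_posPairs [Finite ι] [P.IsCrystallographic] [P.IsReduced] {i : ι}
    (hi : b.IsPos i) : b.height i - 1 = (b.posPairs i).ncard := by
  obtain ⟨n, hn⟩ : ∃ n : ℕ, b.height i = n := ⟨_, (Int.toNat_of_nonneg hi.le).symm⟩
  induction n using Nat.strong_induction_on generalizing i with
  | h n ih =>
    obtain ⟨j, hj, hp⟩ := hi.exists_mem_support_pos_pairingIn
    -- Positivity of the pairing is symmetric in the two roots, though its value is not.
    rw [P.zero_lt_pairingIn_iff'] at hp
    rcases eq_or_ne i j with rfl | hij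
    · simp [posPairs_eq_empty hj, height_one_of_mem_support hj]
    have hi' := hi.reflectionPerm hj hij
    have hht : b.height (P.reflectionPerm j i) = b.height i - P.pairingIn ℤ i j := by
      have := b.height_add_zsmul (i := i) (j := j) (k := P.reflectionPerm j i)
        (z := -P.pairingIn ℤ i j)
        (by rw [root_reflectionPerm, reflection_apply_root' ℤ, neg_smul, sub_eq_add_neg])
      rw [this, height_one_of_mem_support hj, smul_eq_mul]
      lia
    obtain ⟨m, hm⟩ : ∃ m : ℕ, b.height (P.reflectionPerm j i) = m :=
      ⟨_, (Int.toNat_of_nonneg hi'.le).symm⟩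
    have := ih m (by lia) hi' hm
    rw [ncard_posPairs_reflectionPerm hi hj hij hp.le]
    lia

end RootPairing.Base


theorem corollary4p2 {ι K M N : Type*} [Finite ι] [Field K] [CharZero K]
    [AddCommGroup M] [Module K M] [AddCommGroup N] [Module K N]
    (P : RootPairing ι K M N) [P.IsRootSystem] [P.IsCrystallographic] [P.IsReduced]
    [P.IsIrreducible] (b : P.Base) (i : ι) (hi : b.IsPos i) :
    b.height i - 1 =
      (Set.ncard {s : Set ι | ∃ j k : ι, s = {j, k} ∧ b.IsPos j ∧ b.IsPos k ∧
        ∃ m n : ℤ, 0 < m ∧ 0 < n ∧ P.root i = m • P.root j + n • P.root k} : ℤ) := by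
  exact RootPairing.Base.height_sub_one_eq_ncard_posPairs hi
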